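/- A $k$-variety ($k$ a field) is an integral separated scheme of finite type over $\operatorname{Spec} k$; an arithmetic variety is an integral separated scheme of finite type over $\operatorname{Spec}\mathbb Z$. For such an $X$ with generic point $\xi$ let $k(X)=\mathcal O_{X,\xi}$ be its function field; a surjective morphism $\phi:X\to Y$ induces $\phi^\sharp:k(Y)\to k(X)$. Let $\Omega$ be a field. A reduced affine covering of an integral scheme $X$ with values in $\Omega$ is a family of nonempty affine open sets $U_\alpha$ covering $X$, with $U_\alpha\ne U_\beta$ for $\alpha\neq\beta$, together with identifications of the rings $\mathcal O_X(U_\alpha)$ with subrings $A_\alpha$ of $\Omega$, all of which are restrictions of one embedding $k(X)\hookrightarrow\Omega$. The triples $(U_\alpha, \mathcal O_X(U_\alpha)\cong A_\alpha; A_\alpha)$ are its local charts. Let $\phi:X\to Y$ be a surjective morphism of finite type of varieties. $X$ is *quasi-galois closed over $Y$ by $\phi$* if there are an algebraically closed field $\Omega$ and a reduced affine covering $\mathcal C_X$ of $X$ with values in $\Omega$ such that for every $\psi:Z\to Y$ with $Z$ isomorphic to $X$ over $Y$ and every reduced affine covering $\mathcal C_Z$ of $Z$ with values in $\Omega$ that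 induces the same embedding $k(Y)\hookrightarrow\Omega$ (through $\psi^\sharp$) as $\mathcal C_X$ (through $\phi^\sharp$): (i) $X$ and $Z$ are equal as schemes with values in $\Omega$, i.e. there is an isomorphism of schemes $\tau:X\to Z$ such that, for every $f\in k(Z)$, the elements $f$ and $\tau^\sharp f\in k(X)$ have the same image in $\Omega$; and (ii) under this identification each local chart in $\mathcal C_Z$ is a local chart in $\mathcal C_X$. **Theorem 3.26.** Let $X$ and $Y$ be two $k$-varieties for a field $k$, or two arithmetic varieties, such that $X$ is quasi-galois closed over $Y$ by a surjective morphism $\phi:X\to Y$ of finite type. Suppose that $k(X)/\phi^\sharp(k(Y))$ is separably generated, i.e. there is a transcendence basis $S$ of $k(X)$ over $\phi^\sharp(k(Y))$ such that $k(X)$ is separable algebraic over $\phi^\sharp(k(Y))(S)$. Then $k(X)$ is a Galois extension of $\phi^\sharp(k(Y))$, in the sense that $\phi^\sharp(k(Y))$ is the fixed field of the group $\operatorname{Gal}(k(X)/\phi^\sharp(k(Y)))$ of all automorphisms of $k(X)$ over $\phi^\sharp(k(Y))$; and the map sending an automorphism $\sigma$ of $X$ over $Y$ to the automorphism $(\sigma^\sharp)^{-1}$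 of $k(X)$ is a group isomorphism $$\operatorname{Aut}(X/Y)\;\cong\;\operatorname{Gal}\bigl(k(X)/\phi^\sharp(k(Y))\bigr).$$ -/

import Mathlib

open AlgebraicGeometry CategoryTheory

universe u

namespace QuasiGalois

noncomputable section

/-- `X` is an integral separated scheme of finite type over `S`. For `S = Spec k` with `k` a field
these are the `k`-varieties, for `S = Spec ℤ` the arithmetic varieties. -/
def IsVarietyOver (X S : Scheme.{u}) : Prop :=
  IsIntegral X ∧ ∃ s : X ⟶ S, IsSeparated s ∧ LocallyOfFiniteType s ∧ QuasiCompact s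

/-- `X` is a `k`-variety. -/
def IsKVariety (k : Type u) [Field k] (X : Scheme.{u}) : Prop :=
  IsVarietyOver X (Spec (CommRingCat.of k))

/-- `X` is an arithmetic variety (the `ULift` only adjusts the universe of `ℤ`). -/
def IsArithmeticVariety (X : Scheme.{u}) : Prop :=
  IsVarietyOver X (Spec (CommRingCat.of (ULift.{u} ℤ)))

/-- A dominant morphism maps the generic point to the generic point. -/
theorem map_genericPoint {X Y : Scheme.{u}} [IsIntegral X] [IsIntegral Y] (φ : X ⟶ Y)
    [IsDominant φ] : φ (genericPoint X) = genericPoint Y := by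
  have h := (genericPoint_spec X).image φ.continuous
  rw [Set.image_univ, φ.denseRange.closure_range] at h
  exact h.eq (genericPoint_spec Y)

/-- The homomorphism `φ♯ : k(Y) → k(X)` of function fields induced by a dominant morphism `φ`:
the map on stalks at the generic point. -/
def functionFieldMap {X Y : Scheme.{u}} [IsIntegral X] [IsIntegral Y] (φ : X ⟶ Y)
    [IsDominant φ] : Y.functionField →+* X.functionField :=
  (Y.presheaf.stalkSpecializes (specializes_of_eq (map_genericPoint φ)) ≫
    φ.stalkMap (genericPoint X)).hom

/-- The subfield `φ♯(k(Y))` of `k(X)`. -/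
abbrev imageField {X Y : Scheme.{u}} [IsIntegral X] [IsIntegral Y] (φ : X ⟶ Y)
    [IsDominant φ] : Subfield X.functionField :=
  (functionFieldMap φ).fieldRange

/-- A local chart `(U, φ; A)` of `X` with values in `Ω`: a (nonempty) affine open set `U`, a subring
`A` of `Ω` and an identification of `𝒪_X(U)` with `A`, which is the same thing as an isomorphism
of `U` onto `Spec A`. -/
structure LocalChart (X : Scheme.{u}) (Ω : Type u) [Field Ω] where
  U : X.Opens
  nonempty : Nonempty U
  isAffineOpen : IsAffineOpen U
  A : Subring Ω
  equiv : Γ(X, U) ≃+* A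

/-- Transport of a local chart along an isomorphism of schemes. -/
def LocalChart.pullback {X Z : Scheme.{u}} {Ω : Type u} [Field Ω] (c : LocalChart Z Ω)
    (τ : X ≅ Z) : LocalChart X Ω where
  U := τ.hom ⁻¹ᵁ c.U
  nonempty := by
    obtain ⟨z, hz⟩ := c.nonempty
    obtain ⟨x, rfl⟩ := τ.hom.surjective z
    exact ⟨⟨x, hz⟩⟩
  isAffineOpen := c.isAffineOpen.preimage_of_isIso τ.hom
  A := c.A
  equiv := (asIso (τ.hom.app c.U)).commRingCatIsoToRingEquiv.symm.trans c.equiv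

/-- A reduced affine covering of the integral scheme `X` with values in the field `Ω`: a family of
local charts that cover `X`, distinct charts having distinct domains. As usual, for an integral
scheme all the rings `𝒪_X(U)` are regarded as subrings of `k(X)`, and the fraction field of
a subring of `Ω` is taken inside `Ω`; accordingly the identifications of the rings `𝒪_X(U)` with
subrings of `Ω` are the restrictions of one embedding `emb` of `k(X)` into `Ω` (which is determined
by any one of the charts). -/
structure ReducedAffineCovering (X : Scheme.{u}) [IsIntegral X] (Ω : Type u) [Field Ω] where
  charts : Set (LocalChart X Ω)
  covers : ∀ x : X, ∃ c ∈ charts, x ∈ c.U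
  reduced : ∀ c ∈ charts, ∀ d ∈ charts, c.U = d.U → c = d
  emb : X.functionField →+* Ω
  compatible : ∀ c ∈ charts, ∀ s : Γ(X, c.U),
    (c.equiv s : Ω) = emb (haveI := c.nonempty; X.germToFunctionField c.U s)

/-- `X` is quasi-galois closed over `Y` by `φ`: there are an algebraically closed field `Ω` and
a reduced affine covering `C` of `X` with values in `Ω` such that for any conjugate `Z` of `X`
over `Y` (a scheme isomorphic to `X` over `Y`) and any reduced affine covering `D` of `Z` with
values in `Ω`, the schemes `X` and `Z` with values in `Ω` are equal (via `τ`, which identifies the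
points and under which corresponding functions are the same element of `Ω`) and each chart in `D`
is a chart in `C`. Since everything is over `Y`, the field `k(Y)` is mapped to `Ω` in the same way
through `X` and through `Z`. The instances assumed for `Z` and `ψ` are automatic. -/
def IsQuasiGaloisClosed {X Y : Scheme.{u}} [IsIntegral X] [IsIntegral Y] (φ : X ⟶ Y)
    [IsDominant φ] : Prop :=
  ∃ (Ω : Type u) (_ : Field Ω) (_ : IsAlgClosed Ω) (C : ReducedAffineCovering X Ω),
    ∀ (Z : Scheme.{u}) [IsIntegral Z] (ψ : Z ⟶ Y) [IsDominant ψ],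
      (∃ σ : X ≅ Z, σ.hom ≫ ψ = φ) →
      ∀ D : ReducedAffineCovering Z Ω,
        (∀ y : Y.functionField, D.emb (functionFieldMap ψ y) = C.emb (functionFieldMap φ y)) →
        ∃ τ : X ≅ Z,
          (∀ f : Z.functionField, C.emb (functionFieldMap τ.hom f) = D.emb f) ∧
          ∀ d ∈ D.charts, d.pullback τ ∈ C.charts

/-- The group `Aut(X/Y)` of automorphisms of `X` over `Y`; the product `σ * τ` is the composite
"first `τ`, then `σ`". -/
def autOver {X Y : Scheme.{u}} (φ : X ⟶ Y) : Subgroup (Aut X) where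
  carrier := {σ | σ.hom ≫ φ = φ}
  one_mem' := Category.id_comp φ
  mul_mem' {a b} ha hb := by
    change (b.hom ≫ a.hom) ≫ φ = φ
    rw [Category.assoc, show a.hom ≫ φ = φ from ha, show b.hom ≫ φ = φ from hb]
  inv_mem' {a} ha := by
    exact (Iso.inv_comp_eq (show X ≅ X from a)).mpr (show a.hom ≫ φ = φ from ha).symm

/-- The action `(U, f) ↦ (σ(U), (σ♯)⁻¹(f))` of an automorphism `σ` of `X` on the function field
`k(X)`, that is, the inverse of `σ♯ : k(X) → k(X)`. -/
def functionFieldAction {X : Scheme.{u}} [IsIntegral X] (σ : X ≅ X) :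
    X.functionField →+* X.functionField :=
  functionFieldMap σ.inv

/-- The field extension `K / F` is separably generated: there is a transcendence basis of `K` over
`F` such that `K` is separable algebraic over the subfield generated by it. -/
def IsSeparablyGenerated (F K : Type u) [Field F] [Field K] [Algebra F K] : Prop :=
  ∃ s : Set K, IsTranscendenceBasis F ((↑) : s → K) ∧
    Algebra.IsSeparable (IntermediateField.adjoin F s) K

/-- The (not necessarily algebraic) field extension `K / F` is a Galois extension: `F` is the fixed
field of the group of all automorphisms of `K` over `F`. -/
def IsGaloisExtension (F K : Type u) [Field F] [Field K] [Algebra F K] : Prop :=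
  IntermediateField.fixedField (⊤ : Subgroup (K ≃ₐ[F] K)) = ⊥

end

end QuasiGalois

/-! Any embedding `j` of `k(X)` into `Ω` over `k(Y)` defines a reduced affine covering of `X`.
Testing quasi-galois closedness with `Z = X` on this covering gives an automorphism `τ` of `X` with
`C.emb ∘ τ♯ = j`; it lies over `Y`, since morphisms to a separated scheme are determined on function
fields (`exists_autOver_of_embedding`). Taking `j = C.emb ∘ g` shows that `Aut(X/Y)` maps onto the
Galois group; the map is injective because `X` is separated.

Consequently an element fixed by all automorphisms has the same image under all embeddings into `Ω`.
It cannot be transcendental, as embeddings can shift it by 1, and it has no other conjugates, so it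
is purely inseparable over the base. In a separably generated extension such an element lies in the
base. -/

namespace QuasiGalois

/-! ### Embeddings into an algebraically closed field and purely inseparable elements -/

section FieldTheory

open IntermediateField

/-- An embedding of a field extension into an algebraically closed field can be prescribed on
a transcendence basis, as long as the images are algebraically independent. -/
theorem exists_algHom_apply_transcendenceBasis {ι F K Ω : Type*} [Field F] [Field K] [Field Ω]
    [IsAlgClosed Ω] [Algebra F K] [Algebra F Ω] {x : ι → K} (hx : IsTranscendenceBasis F x)
    {x' : ι → Ω} (hx' : AlgebraicIndependent F x') : ∃ j : K →ₐ[F] Ω, ∀ i, j (x i) = x' i := by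
  let R := Algebra.adjoin F (Set.range x)
  let f : R →ₐ[F] Ω := (MvPolynomial.aeval x').comp hx.1.aevalEquiv.symm.toAlgHom
  have hf : Function.Injective f :=
    (algebraicIndependent_iff_injective_aeval.mp hx').comp hx.1.aevalEquiv.symm.injective
  have hfx (i : ι) : f ⟨x i, Algebra.subset_adjoin ⟨i, rfl⟩⟩ = x' i := by
    have : hx.1.aevalEquiv.symm ⟨x i, Algebra.subset_adjoin ⟨i, rfl⟩⟩ = MvPolynomial.X i := by
      rw [AlgEquiv.symm_apply_eq]
      ext
      simp
    change MvPolynomial.aeval x' (hx.1.aevalEquiv.symm _) = _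
    rw [this, MvPolynomial.aeval_X]
  -- `K` is algebraic over the polynomial ring `R`, so the injection `f` of `R` into `Ω` extends to
  -- `K`.
  let _ : Algebra R Ω := f.toRingHom.toAlgebra
  have : IsScalarTower F R Ω := .of_algebraMap_eq fun a => (f.commutes a).symm
  have : FaithfulSMul R Ω := (faithfulSMul_iff_algebraMap_injective R Ω).mpr hf
  have : Algebra.IsAlgebraic R K := hx.isAlgebraic
  let j : K →ₐ[R] Ω := IsAlgClosed.lift
  exact ⟨j.restrictScalars F, fun i =>
    (j.commutes ⟨x i, Algebra.subset_adjoin ⟨i, rfl⟩⟩).trans (hfx i)⟩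

/-- Adding `1` to each member preserves algebraic independence. -/
theorem algebraicIndependent_add_one {ι F A : Type*} [CommRing F] [CommRing A] [Algebra F A]
    {x : ι → A} (hx : AlgebraicIndependent F x) :
    AlgebraicIndependent F (fun i => x i + 1) := by
  rw [algebraicIndependent_iff_injective_aeval] at hx ⊢
  let s : MvPolynomial ι F →ₐ[F] MvPolynomial ι F :=
    MvPolynomial.aeval fun i => MvPolynomial.X i + 1
  let t : MvPolynomial ι F →ₐ[F] MvPolynomial ι F :=
    MvPolynomial.aeval fun i => MvPolynomial.X i - 1
  have hts : Function.LeftInverse t s := fun p => by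
    have : t.comp s = AlgHom.id F _ := by ext i; simp [s, t]
    exact DFunLike.congr_fun this p
  have : MvPolynomial.aeval (fun i => x i + 1) = (MvPolynomial.aeval (R := F) x).comp s := by
    ext i; simp [s]
  rw [this]
  exact hx.comp hts.injective

/-- An embedding of an algebraic subextension into an algebraically closed field `Ω` extends to the
whole extension, as soon as there is some embedding of the latter into `Ω`. -/
theorem exists_algHom_extend {F K Ω : Type*} [Field F] [Field K] [Field Ω]
    [IsAlgClosed Ω] [Algebra F K] [Algebra F Ω] (i : K →ₐ[F] Ω) (E : IntermediateField F K)
    [Algebra.IsAlgebraic F E] (e : E →ₐ[F] Ω) :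
    ∃ j : K →ₐ[F] Ω, ∀ a : E, j a = e a := by
  obtain ⟨s, hs⟩ := exists_isTranscendenceBasis F K
  have hsE : IsTranscendenceBasis E ((↑) : s → K) :=
    (Algebra.IsAlgebraic.isTranscendenceBasis_iff F E).mp hs
  let _ : Algebra E Ω := e.toRingHom.toAlgebra
  have : IsScalarTower F E Ω := .of_algebraMap_eq fun a => (e.commutes a).symm
  -- The only role of `i` is to supply enough independent elements of `Ω`: the `i`-images of `s`
  -- stay independent over `e(E)`, which is algebraic over `F`.
  obtain ⟨j, -⟩ := exists_algHom_apply_transcendenceBasis hsE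
    ((hs.1.map' i.injective).extendScalars (S := E))
  exact ⟨j.restrictScalars F, j.commutes⟩

/-- An element of `K` on which all embeddings into an algebraically closed field `Ω` agree is
purely inseparable over `F`. -/
theorem mem_perfectClosure_of_forall_algHom_eq {F K Ω : Type*} [Field F] [Field K] [Field Ω]
    [IsAlgClosed Ω] [Algebra F K] [Algebra F Ω] (i : K →ₐ[F] Ω) {y : K}
    (hy : ∀ j : K →ₐ[F] Ω, j y = i y) : y ∈ perfectClosure F K := by
  have halg : IsAlgebraic F y := by
    -- A transcendental `y` belongs to a transcendence basis; sending each basis element `b` to `i b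
    -- + 1` gives an embedding that differs from `i` at `y`.
    by_contra htr
    have hind : AlgebraicIndepOn F id ({y} : Set K) :=
      algebraicIndependent_unique_type_iff.mpr htr
    obtain ⟨s, hys, hs⟩ := exists_isTranscendenceBasis_superset hind
    obtain ⟨j, hj⟩ := exists_algHom_apply_transcendenceBasis hs
      (algebraicIndependent_add_one (hs.1.map' i.injective))
    have := (hj ⟨y, hys rfl⟩).symm.trans (hy j)
    simp at this
  have hint : IsIntegral F y := halg.isIntegral
  classical
  -- It remains to see that `i y` is the only root of the minimal polynomial in `Ω`: any root `z` is
  -- the image of `y` under some embedding of `K`.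
  rw [mem_perfectClosure_iff_natSepDegree_eq_one, Polynomial.natSepDegree_eq_of_isAlgClosed Ω]
  refine Finset.card_eq_one.mpr ⟨i y, Finset.ext fun z => ?_⟩
  rw [Multiset.mem_toFinset, Finset.mem_singleton]
  constructor
  · intro hz
    have : Algebra.IsAlgebraic F F⟮y⟯ := isAlgebraic_adjoin_simple hint
    obtain ⟨j, hj⟩ := exists_algHom_extend i F⟮y⟯
      ((algHomAdjoinIntegralEquiv F hint).symm ⟨z, hz⟩)
    have := hj (AdjoinSimple.gen F y)
    rw [algHomAdjoinIntegralEquiv_symm_apply_gen, AdjoinSimple.coe_gen, hy j] at this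
    exact this.symm
  · rintro rfl
    rw [Polynomial.mem_aroots]
    exact ⟨minpoly.ne_zero hint, by rw [Polynomial.aeval_algHom_apply]; simp⟩

/-- The base field is algebraically closed in a purely transcendental extension. -/
theorem mem_bot_of_isAlgebraic_of_mem_adjoin {ι F K : Type*} [Field F] [Field K] [Algebra F K]
    {x : ι → K} (hx : AlgebraicIndependent F x) {y : K} (hy : IsAlgebraic F y)
    (hyx : y ∈ adjoin F (Set.range x)) : y ∈ (⊥ : IntermediateField F K) := by
  obtain ⟨r, s, hrs⟩ := (mem_adjoin_range_iff F x y).mp hyx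
  by_cases hs : s = 0
  · rw [hrs, hs, map_zero, div_zero]
    exact zero_mem _
  have hs' : MvPolynomial.aeval x s ≠ 0 := fun h => hs (hx.eq_zero_of_aeval_eq_zero _ h)
  have : Algebra.IsAlgebraic F F⟮y⟯ := isAlgebraic_adjoin_simple hy.isIntegral
  have hxE : AlgebraicIndependent F⟮y⟯ x := hx.extendScalars F⟮y⟯
  let γ : F⟮y⟯ := AdjoinSimple.gen F y
  -- As `x` stays independent over `F(y)`, the relation `y * s(x) = r(x)` is an identity of
  -- polynomials; a nonzero coefficient of `s` then exhibits `y` as a quotient of elements of `F`.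
  have key : MvPolynomial.C γ * MvPolynomial.map (algebraMap F F⟮y⟯) s
      = MvPolynomial.map (algebraMap F F⟮y⟯) r := by
    apply algebraicIndependent_iff_injective_aeval.mp hxE
    rw [map_mul, MvPolynomial.aeval_map_algebraMap, MvPolynomial.aeval_map_algebraMap,
      MvPolynomial.aeval_C]
    exact ((eq_div_iff hs').mp hrs)
  obtain ⟨m, hm⟩ := MvPolynomial.ne_zero_iff.mp hs
  have hc := congr_arg (fun p => algebraMap F⟮y⟯ K (MvPolynomial.coeff m p)) key
  simp only [MvPolynomial.coeff_C_mul, MvPolynomial.coeff_map, map_mul,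
    ← IsScalarTower.algebraMap_apply] at hc
  have hc' : y * algebraMap F K (s.coeff m) = algebraMap F K (r.coeff m) := hc
  rw [← eq_div_iff (by simpa using hm), ← map_div₀] at hc'
  exact mem_bot.mpr ⟨_, hc'.symm⟩

/-- A separably generated extension contains no purely inseparable elements outside of the base. -/
theorem IsSeparablyGenerated.perfectClosure_eq_bot {F K : Type u} [Field F] [Field K] [Algebra F K]
    (h : IsSeparablyGenerated F K) : perfectClosure F K = ⊥ := by
  obtain ⟨s, hs, hsep⟩ := h
  refine eq_bot_iff.mpr fun y hy => ?_
  have hyalg : IsAlgebraic F y := by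
    have := (perfectClosure.isAlgebraic F K).isAlgebraic ⟨y, hy⟩
    exact (isAlgebraic_algHom_iff (perfectClosure F K).val Subtype.val_injective).mpr this
  refine mem_bot_of_isAlgebraic_of_mem_adjoin hs.1 hyalg ?_
  rw [Subtype.range_coe]
  -- Being purely inseparable over `F`, `y` is so over `F(s)`, where `K` is separable; hence `y ∈
  -- F(s)`.
  have hy' : y ∈ perfectClosure (adjoin F s) K := by
    obtain ⟨n, a, ha⟩ := mem_perfectClosure_iff.mp hy
    have : ExpChar (adjoin F s) (ringExpChar F) :=
      expChar_of_injective_algebraMap (algebraMap F (adjoin F s)).injective _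
    exact (mem_perfectClosure_iff_pow_mem (ringExpChar F)).mpr ⟨n, algebraMap F _ a, ha⟩
  rw [perfectClosure.eq_bot_of_isSeparable] at hy'
  obtain ⟨a, rfl⟩ := mem_bot.mp hy'
  exact a.2

/-- If the extension `K / F` is separably generated and any two embeddings of `K` into an
algebraically closed field differ by an automorphism, then `K / F` is a Galois extension. -/
theorem IsSeparablyGenerated.isGaloisExtension {F K : Type u} {Ω : Type*} [Field F] [Field K]
    [Field Ω] [IsAlgClosed Ω] [Algebra F K] [Algebra F Ω] (h : IsSeparablyGenerated F K)
    (i : K →ₐ[F] Ω) (hi : ∀ j : K →ₐ[F] Ω, ∃ g : K ≃ₐ[F] K, ∀ a, i (g a) = j a) :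
    IsGaloisExtension F K := by
  refine eq_bot_iff.mpr fun y hy => ?_
  rw [← h.perfectClosure_eq_bot]
  refine mem_perfectClosure_of_forall_algHom_eq i fun j => ?_
  obtain ⟨g, hg⟩ := hi j
  rw [← hg, show g y = y from hy ⟨g, trivial⟩]

end FieldTheory

/-! ### Functoriality of function fields -/

section FunctionField

variable {X Y Z : Scheme.{u}} [IsIntegral X] [IsIntegral Y] [IsIntegral Z]

theorem specMap_functionFieldMap_fromSpecStalk (φ : X ⟶ Y) [IsDominant φ] :
    Spec.map (CommRingCat.ofHom (functionFieldMap φ)) ≫ Y.fromSpecStalk (genericPoint Y) =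
      X.fromSpecStalk (genericPoint X) ≫ φ := by
  rw [functionFieldMap, CommRingCat.ofHom_hom, Spec.map_comp, Category.assoc,
    Scheme.SpecMap_stalkSpecializes_fromSpecStalk, Scheme.SpecMap_stalkMap_fromSpecStalk]

/-- Since `Y.fromSpecStalk` is a monomorphism, the square over the generic points characterizes
`φ♯`. Functoriality then follows by pasting squares, without handling the transport between stalks.
-/
theorem functionFieldMap_eq_iff (φ : X ⟶ Y) [IsDominant φ]
    (g : Y.functionField →+* X.functionField) :
    functionFieldMap φ = g ↔
      Spec.map (CommRingCat.ofHom g) ≫ Y.fromSpecStalk (genericPoint Y) =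
        X.fromSpecStalk (genericPoint X) ≫ φ := by
  rw [← specMap_functionFieldMap_fromSpecStalk, cancel_mono, Spec.map_inj]
  exact ⟨fun h => by rw [h], fun h => (congr_arg CommRingCat.Hom.hom h).symm⟩

theorem functionFieldMap_id : functionFieldMap (𝟙 X) = RingHom.id _ := by
  rw [functionFieldMap_eq_iff, CommRingCat.ofHom_id, Spec.map_id, Category.id_comp,
    Category.comp_id]

theorem functionFieldMap_comp (φ : X ⟶ Y) (ψ : Y ⟶ Z) [IsDominant φ] [IsDominant ψ]
    [IsDominant (φ ≫ ψ)] :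
    functionFieldMap (φ ≫ ψ) = (functionFieldMap φ).comp (functionFieldMap ψ) := by
  rw [functionFieldMap_eq_iff, CommRingCat.ofHom_comp, Spec.map_comp, Category.assoc,
    specMap_functionFieldMap_fromSpecStalk, ← Category.assoc,
    specMap_functionFieldMap_fromSpecStalk, Category.assoc]

theorem functionFieldMap_comp_apply_of_eq {φ : X ⟶ Y} {ψ : Y ⟶ Z} {χ : X ⟶ Z} [IsDominant φ]
    [IsDominant ψ] [IsDominant χ] (h : φ ≫ ψ = χ) (f : Z.functionField) :
    functionFieldMap φ (functionFieldMap ψ f) = functionFieldMap χ f := by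
  subst h
  rw [functionFieldMap_comp]
  rfl

theorem functionFieldMap_hom_inv (σ : X ≅ Y) (f : X.functionField) :
    functionFieldMap σ.hom (functionFieldMap σ.inv f) = f := by
  rw [functionFieldMap_comp_apply_of_eq σ.hom_inv_id, functionFieldMap_id, RingHom.id_apply]

instance : IsDominant (X.fromSpecStalk (genericPoint X)) := by
  refine ⟨dense_iff_closure_eq.mpr (Set.univ_subset_iff.mp ?_)⟩
  rw [← (genericPoint_spec X).def]
  refine closure_mono (Set.singleton_subset_iff.mpr ?_)
  rw [Scheme.range_fromSpecStalk]
  exact specializes_rfl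

/-- A dominant morphism from an integral scheme to a separated one is determined by its effect
on the function fields. -/
theorem functionFieldMap_injective [Y.IsSeparated] {φ ψ : X ⟶ Y} [IsDominant φ] [IsDominant ψ]
    (h : functionFieldMap φ = functionFieldMap ψ) : φ = ψ :=
  ext_of_isDominant (X.fromSpecStalk (genericPoint X)) <| by
    rw [← specMap_functionFieldMap_fromSpecStalk, h, specMap_functionFieldMap_fromSpecStalk]

end FunctionField

/-! ### The covering attached to an embedding of the function field -/

section Covering

variable {X : Scheme.{u}} [IsIntegral X] {Ω : Type u} [Field Ω]

/-- The local chart of an affine open subset induced by an embedding of the function field. -/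
noncomputable def LocalChart.ofEmbedding (j : X.functionField →+* Ω) (U : X.Opens) [hU : Nonempty U]
    (hU' : IsAffineOpen U) : LocalChart X Ω where
  U := U
  nonempty := hU
  isAffineOpen := hU'
  A := (j.comp (X.germToFunctionField U).hom).range
  equiv := RingEquiv.ofBijective (j.comp (X.germToFunctionField U).hom).rangeRestrict
    ⟨fun _ _ h => X.germToFunctionField_injective U (j.injective (congr_arg Subtype.val h)),
      RingHom.rangeRestrict_surjective _⟩

/-- The reduced affine covering by all nonempty affine open subsets induced by an embedding of
the function field. -/
noncomputable def ReducedAffineCovering.ofEmbedding (j : X.functionField →+* Ω) :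
    ReducedAffineCovering X Ω where
  charts := {c | ∃ (U : X.Opens) (_ : Nonempty U) (hU : IsAffineOpen U),
    c = LocalChart.ofEmbedding j U hU}
  covers x := by
    obtain ⟨_, ⟨U, hU, rfl⟩, hxU, -⟩ :=
      X.isBasis_affineOpens.exists_subset_of_mem_open (Set.mem_univ x) isOpen_univ
    exact ⟨_, ⟨U, ⟨⟨x, hxU⟩⟩, hU, rfl⟩, hxU⟩
  reduced := by
    rintro _ ⟨U, _, hU, rfl⟩ _ ⟨V, _, hV, rfl⟩ h
    obtain rfl : U = V := h
    rfl
  emb := j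
  compatible := by
    rintro _ ⟨U, _, hU, rfl⟩ s
    rfl

end Covering

theorem IsVarietyOver.isSeparated {X S : Scheme.{u}} [S.IsSeparated] (h : IsVarietyOver X S) :
    X.IsSeparated := by
  obtain ⟨-, s, hs, -, -⟩ := h
  refine ⟨?_⟩
  rw [← Limits.terminal.comp_from s]
  infer_instance

/-! ### Automorphisms over the base acting on the function field -/

section AutOver

variable {X Y : Scheme.{u}} [IsIntegral X] [IsIntegral Y]

/-- The isomorphism of schemes underlying an automorphism of `X` over `Y`. -/
abbrev autOver.iso {φ : X ⟶ Y} (σ : autOver φ) : X ≅ X :=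
  (σ : Aut X)

/-- The action of the automorphisms of `X` over `Y` on the function field of `X`. -/
noncomputable def autOverToGal (φ : X ⟶ Y) [IsDominant φ] :
    autOver φ →* (X.functionField ≃ₐ[imageField φ] X.functionField) where
  toFun σ := AlgEquiv.ofRingEquiv
    (f := RingEquiv.ofRingHom (functionFieldMap (autOver.iso σ).inv)
      (functionFieldMap (autOver.iso σ).hom)
      (RingHom.ext (functionFieldMap_hom_inv (autOver.iso σ).symm))
      (RingHom.ext (functionFieldMap_hom_inv (autOver.iso σ)))) <| by
        rintro ⟨_, y, rfl⟩
        exact functionFieldMap_comp_apply_of_eq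
          ((Iso.inv_comp_eq (autOver.iso σ)).mpr σ.2.symm) y
  map_one' := AlgEquiv.ext fun f => DFunLike.congr_fun (functionFieldMap_id (X := X)) f
  map_mul' σ τ := AlgEquiv.ext fun f => (functionFieldMap_comp_apply_of_eq
    (φ := (autOver.iso σ).inv) (ψ := (autOver.iso τ).inv)
    (χ := (autOver.iso (σ * τ)).inv) rfl f).symm

theorem autOverToGal_apply (φ : X ⟶ Y) [IsDominant φ] (σ : autOver φ) (f : X.functionField) :
    autOverToGal φ σ f = functionFieldAction (σ : Aut X) f :=
  rfl

theorem autOverToGal_injective [X.IsSeparated] (φ : X ⟶ Y) [IsDominant φ] :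
    Function.Injective (autOverToGal φ) := by
  intro σ τ h
  have hinv : (autOver.iso σ).inv = (autOver.iso τ).inv :=
    functionFieldMap_injective (RingHom.ext fun f => DFunLike.congr_fun h f)
  exact Subtype.ext (congr_arg Iso.symm (Iso.ext hinv :
    (autOver.iso σ).symm = (autOver.iso τ).symm))

/-- All embeddings over `k(Y)` of the function field of a quasi-galois closed `X` into `Ω` come from
automorphisms of `X` over `Y`. -/
theorem exists_autOver_of_embedding [Y.IsSeparated] {φ : X ⟶ Y} [IsDominant φ]
    {Ω : Type u} [Field Ω] {C : ReducedAffineCovering X Ω}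
    (hC : ∀ D : ReducedAffineCovering X Ω,
      (∀ y : Y.functionField, D.emb (functionFieldMap φ y) = C.emb (functionFieldMap φ y)) →
        ∃ τ : X ≅ X, ∀ f : X.functionField, C.emb (functionFieldMap τ.hom f) = D.emb f)
    (j : X.functionField →+* Ω)
    (hj : ∀ y : Y.functionField, j (functionFieldMap φ y) = C.emb (functionFieldMap φ y)) :
    ∃ σ : autOver φ, ∀ f : X.functionField, C.emb (autOverToGal φ σ f) = j f := by
  obtain ⟨τ, hτ⟩ := hC (.ofEmbedding j) hj
  -- `τ` is only given as an isomorphism of schemes; it lies over `Y` because `j` and `C.emb` agree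
  -- on `k(Y)`.
  have hτφ : τ.hom ≫ φ = φ := functionFieldMap_injective <| RingHom.ext fun y =>
    C.emb.injective <| by
      rw [functionFieldMap_comp, RingHom.comp_apply, hτ]
      exact hj y
  -- The action uses the inverse of `σ♯`, so `τ⁻¹` acts as `τ♯`.
  exact ⟨⟨τ.symm, (Iso.inv_comp_eq τ).mpr hτφ.symm⟩, hτ⟩

end AutOver

end QuasiGalois

open QuasiGalois in
theorem theorem3p26 {X Y : Scheme.{u}} [IsIntegral X] [IsIntegral Y]
    (hXY : (∃ (k : Type u) (_ : Field k),
        QuasiGalois.IsKVariety k X ∧ QuasiGalois.IsKVariety k Y) ∨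
      (QuasiGalois.IsArithmeticVariety X ∧ QuasiGalois.IsArithmeticVariety Y))
    (φ : X ⟶ Y) [Surjective φ] [LocallyOfFiniteType φ] [QuasiCompact φ]
    (hqgc : QuasiGalois.IsQuasiGaloisClosed φ)
    (hsep : QuasiGalois.IsSeparablyGenerated (QuasiGalois.imageField φ) X.functionField) :
    QuasiGalois.IsGaloisExtension (QuasiGalois.imageField φ) X.functionField ∧
      ∃ t : QuasiGalois.autOver φ ≃*
          (X.functionField ≃ₐ[QuasiGalois.imageField φ] X.functionField),
        ∀ (σ : QuasiGalois.autOver φ) (f : X.functionField),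
          t σ f = QuasiGalois.functionFieldAction (σ : Aut X) f := by
  have : X.IsSeparated ∧ Y.IsSeparated := by
    rcases hXY with ⟨k, _, hX, hY⟩ | ⟨hX, hY⟩
    exacts [⟨hX.isSeparated, hY.isSeparated⟩, ⟨hX.isSeparated, hY.isSeparated⟩]
  obtain ⟨_, _⟩ := this
  obtain ⟨Ω, _, _, C, hC⟩ := hqgc
  have hC' (D : ReducedAffineCovering X Ω)
      (hD : ∀ y, D.emb (functionFieldMap φ y) = C.emb (functionFieldMap φ y)) :
      ∃ τ : X ≅ X, ∀ f, C.emb (functionFieldMap τ.hom f) = D.emb f := by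
    obtain ⟨τ, hτ, -⟩ := hC X φ ⟨Iso.refl X, Category.id_comp φ⟩ D hD
    exact ⟨τ, hτ⟩
  let _ : Algebra (imageField φ) Ω :=
    (C.emb.comp (algebraMap (imageField φ) X.functionField)).toAlgebra
  let i : X.functionField →ₐ[imageField φ] Ω := { C.emb with commutes' := fun _ => rfl }
  have hi (j : X.functionField →ₐ[imageField φ] Ω) :
      ∃ σ : autOver φ, ∀ f, i (autOverToGal φ σ f) = j f :=
    exists_autOver_of_embedding hC' j fun y => j.commutes ⟨_, y, rfl⟩
  refine ⟨hsep.isGaloisExtension i fun j => ?_,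
    MulEquiv.ofBijective (autOverToGal φ) ⟨autOverToGal_injective φ, fun g => ?_⟩,
    autOverToGal_apply φ⟩
  · obtain ⟨σ, hσ⟩ := hi j
    exact ⟨autOverToGal φ σ, hσ⟩
  -- The automorphism realizing `i ∘ g` acts as `g`, because `i` is injective.
  · obtain ⟨σ, hσ⟩ := hi (i.comp g.toAlgHom)
    exact ⟨σ, AlgEquiv.ext fun f => i.injective (hσ f)⟩
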